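/- Let $\mathbb{k}:\mathbb{Z}_+\times\mathbb{Z}_+\to\mathbb{R}$ be a stable Mercer kernel: $\mathbb{k}$ is non-zero, symmetric and positive semidefinite, and $\sum_{t\ge 0}\bigl|\sum_{s\ge 0}u_s\mathbb{k}(t,s)\bigr|<\infty$ for every bounded real sequence $(u_s)_{s\ge 0}$. Let $\mathcal{H}_{\mathbb{k}}\subseteq\mathbb{R}^{\mathbb{Z}_+}$ be the real reproducing kernel Hilbert space with kernel $\mathbb{k}$. Let $u=(u_t)_{t\in\mathbb{Z}}$ be a bounded real input signal, and put $L_t(g)=\sum_{s\ge 0}g_s u_{t-s}$ for $g\in\ell^1(\mathbb{Z}_+)$ and $t\in\mathbb{Z}$. Let $t_0,\dots,t_{N-1}\in\mathbb{Z}$ be measurement times with measured outputs $y_{t_0},\dots,y_{t_{N-1}}\in\mathbb{R}$, let $\rho\in(0,1)$, $\lambda>0$ and $a_{\min}>0$, and let $f_\rho=(\rho^t)_{t\ge 0}$. Consider the optimization problem $$\min_{a\in\mathbb{R},\ h\in\mathcal{H}_{\mathbb{k}}}\ \sum_{i=0}^{N-1}\bigl(y_{t_i}-a\,L_{t_i}(f_\rho)-L_{t_i}(h)\bigr)^2+\lambda\|h\|_{\mathcal{H}_{\mathbb{k}}}^2$$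 subject to $h_t+a\rho^t\ge 0$ for all $t\ge 0$, $\operatorname{rank}(\mathrm{Hankel}(h))<\infty$, and $a\ge a_{\min}$. Here $\mathrm{Hankel}(h)$ maps $v\in\ell^\infty$ to the sequence $\bigl(\sum_{j\ge 0}h_{i+j}v_j\bigr)_{i\ge 0}$, and its rank is the dimension of its range. Assume that there are $C\ge 0$ and $\rho_{\mathrm d}\in(0,\rho)$ with $|\mathbb{k}(t,t)|\le C\rho_{\mathrm d}^{2t}$ for all $t\in\mathbb{Z}_+$. Let $(a,h)$ be a solution (a minimizer) of this problem, and let $g_t=h_t+a\rho^t$ for $t\in\mathbb{Z}_+$. Then $g=(g_t)_{t\ge 0}$ is a stable impulse response, that is, $g\in\ell^1$, and it is internally positive: there are $n\ge 1$, $A\in\mathbb{R}^{n\times n}$, $b\in\mathbb{R}^n$, $c\in\mathbb{R}^{1\times n}$ and $d\in\mathbb{R}$ such that the system $x_{t+1}=Ax_t+bu_t$, $y_t=cx_t+du_t$ has impulse response $g$ (that is, $g$ is its output for $x_0=0$ and the unit impulse input at time $0$) and such that, whenever $x_0\in\mathbb{R}^n_+$ and $u_t\ge 0$ for all $t\ge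 0$, one has $x_t\in\mathbb{R}^n_+$ and $y_t\ge 0$ for all $t\ge 0$. -/

import Mathlib

open scoped ENNReal Matrix

noncomputable section

namespace PosIdent

/-! ### State-space systems and internal positivity -/

/-- The state at time `t ≥ 0` of `x_{t+1} = A x_t + b u_t`, started at `x_0 = x₀`. -/
def state {n : ℕ} (A : Matrix (Fin n) (Fin n) ℝ) (b x₀ : Fin n → ℝ) (u : ℕ → ℝ) :
    ℕ → Fin n → ℝ
  | 0 => x₀
  | t + 1 => A *ᵥ state A b x₀ u t + u t • b

/-- The output `y_t = c x_t + d u_t`. -/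
def output {n : ℕ} (A : Matrix (Fin n) (Fin n) ℝ) (b c : Fin n → ℝ) (d : ℝ)
    (x₀ : Fin n → ℝ) (u : ℕ → ℝ) (t : ℕ) : ℝ :=
  c ⬝ᵥ state A b x₀ u t + d * u t

/-- `(A, b, c, d)` is a realization of `g`: its impulse response (the output for zero initial
state and the unit impulse at time `0` as input) is `g`. -/
def IsRealization {n : ℕ} (A : Matrix (Fin n) (Fin n) ℝ) (b c : Fin n → ℝ) (d : ℝ)
    (g : ℕ → ℝ) : Prop :=
  ∀ t, output A b c d 0 (Pi.single 0 1) t = g t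

/-- A positive system: for every non-negative initial state and every non-negative input, the
states and the outputs are non-negative at all times `t ≥ 0`. -/
def IsPositiveSystem {n : ℕ} (A : Matrix (Fin n) (Fin n) ℝ) (b c : Fin n → ℝ) (d : ℝ) : Prop :=
  ∀ (x₀ : Fin n → ℝ) (u : ℕ → ℝ), (∀ i, 0 ≤ x₀ i) → (∀ t, 0 ≤ u t) →
    ∀ t, (∀ i, 0 ≤ state A b x₀ u t i) ∧ 0 ≤ output A b c d x₀ u t

/-- `g` is internally positive: it has a positive realization of some finite order `n ≥ 1`. -/
def IsInternallyPositive (g : ℕ → ℝ) : Prop :=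
  ∃ (n : ℕ) (A : Matrix (Fin n) (Fin n) ℝ) (b c : Fin n → ℝ) (d : ℝ),
    0 < n ∧ IsRealization A b c d g ∧ IsPositiveSystem A b c d

/-! ### Hankel rank -/

/-- The Hankel operator of `g` applied to `v`: the sequence `i ↦ ∑_j g_{i+j} v_j`. -/
def hankel (g v : ℕ → ℝ) (i : ℕ) : ℝ :=
  ∑' j, g (i + j) * v j

/-- `rank (Hankel g) < ∞`, the rank being the dimension of the space of all `Hankel(g) v` with
`v ∈ ℓ^∞`. For `g ∈ ℓ^1` these sequences already form a subspace, so that taking the span only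
serves to have a subspace in Lean. -/
def FiniteHankelRank (g : ℕ → ℝ) : Prop :=
  Module.rank ℝ (Submodule.span ℝ {w : ℕ → ℝ | ∃ v : ℕ → ℝ, Memℓp v ∞ ∧ w = hankel g v}) <
    Cardinal.aleph0

/-! ### Kernels and reproducing kernel Hilbert spaces -/

/-- Mercer kernels on `ℤ_+`: non-zero, symmetric, positive semidefinite. -/
def IsMercerKernel (k : ℕ → ℕ → ℝ) : Prop :=
  k ≠ 0 ∧ (∀ s t, k s t = k t s) ∧
    ∀ (m : ℕ) (t : Fin m → ℕ) (a : Fin m → ℝ), 0 ≤ ∑ i, ∑ j, a i * k (t i) (t j) * a j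

/-- Stable kernels: `∑_t |∑_s u_s k(t,s)| < ∞` for every bounded `u` (all series convergent). -/
def IsStableKernel (k : ℕ → ℕ → ℝ) : Prop :=
  ∀ u : ℕ → ℝ, Memℓp u ∞ →
    (∀ t, Summable fun s => u s * k t s) ∧ Summable fun t => |∑' s, u s * k t s|

/-- The Hilbert space `H` of real sequences has `k` as its kernel: every section `k(t, ·)` lies
in `H` and has the reproducing property. -/
def HasKernel (H : Type*) [NormedAddCommGroup H] [InnerProductSpace ℝ H] [RKHS ℝ H ℕ ℝ]
    (k : ℕ → ℕ → ℝ) : Prop :=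
  ∀ t, ∃ kt : H, (∀ s, kt s = k t s) ∧ ∀ g : H, inner ℝ g kt = g t

/-! ### The identification problem -/

/-- `L_t(g) = ∑_{s ≥ 0} g_s u_{t-s}`, the noiseless output at time `t` for the input `u`. -/
def convAt (u : ℤ → ℝ) (t : ℤ) (g : ℕ → ℝ) : ℝ :=
  ∑' s : ℕ, g s * u (t - s)

section
variable {H : Type*} [NormedAddCommGroup H] [InnerProductSpace ℝ H] [RKHS ℝ H ℕ ℝ]

/-- The cost `∑_i (y_{t_i} - a L_{t_i}(f_ρ) - L_{t_i}(h))² + lam ‖h‖²`, `f_ρ = (ρ^t)_t`. -/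
def cost {N : ℕ} (u : ℤ → ℝ) (τ : Fin N → ℤ) (y : Fin N → ℝ) (ρ lam : ℝ) (p : ℝ × H) : ℝ :=
  ∑ i, (y i - p.1 * convAt u (τ i) (fun t => ρ ^ t) - convAt u (τ i) p.2) ^ 2 + lam * ‖p.2‖ ^ 2

/-- The feasible set: `h_t + a ρ^t ≥ 0` for all `t`, `rank (Hankel h) < ∞`, and `a ≥ a_min`. -/
def feasible (ρ aMin : ℝ) : Set (ℝ × H) :=
  {p | (∀ t : ℕ, 0 ≤ p.2 t + p.1 * ρ ^ t) ∧ FiniteHankelRank p.2 ∧ aMin ≤ p.1}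

/-- `(a, h)` solves the problem: it is feasible and minimizes the cost over the feasible set. -/
def IsSolution {N : ℕ} (u : ℤ → ℝ) (τ : Fin N → ℤ) (y : Fin N → ℝ) (ρ lam aMin : ℝ)
    (a : ℝ) (h : H) : Prop :=
  (a, h) ∈ feasible (H := H) ρ aMin ∧
    IsMinOn (cost (H := H) u τ y ρ lam) (feasible ρ aMin) (a, h)

end

end PosIdent

end

namespace PosIdent

open scoped NNReal Topology

/-! ### Positive realizations from shift-invariant cones -/

/-! Dividing `g` by `ρ ^ t` leaves `a + e` with `e t = ρ⁻¹ ^ t * h t`. The reproducing property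
bounds `h t` by a multiple of `ρd ^ t` with `ρd < ρ`, so `e` tends to `0`; finite Hankel rank makes
its shifts span a finite-dimensional space. A positive realization comes from a finitely generated,
shift-invariant cone containing `a + e`. The shift fixes the constant `a` and contracts the `e` part
in the long run. Hence the cone over the shifts `i < m` of `a ± ε e` and `a + e` is invariant for
large `m`: the `m`-th shift of `e` is so small a combination of earlier ones that adding it to `a`
stays inside the cross-polytope around `a` (`add_sum_smul_mem_cone`, `exists_shift_eq_sum`). The
coefficients of the shift on the generators give non-negative matrices
(`isInternallyPositive_of_mem_cone`). -/

/-- With non-negative matrices a system is positive. -/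
theorem isPositiveSystem_of_nonneg {n : ℕ} {A : Matrix (Fin n) (Fin n) ℝ} {b c : Fin n → ℝ}
    {d : ℝ} (hA : ∀ i j, 0 ≤ A i j) (hb : ∀ i, 0 ≤ b i) (hc : ∀ i, 0 ≤ c i) (hd : 0 ≤ d) :
    IsPositiveSystem A b c d := by
  intro x₀ u hx hu t
  have hstate : ∀ t i, 0 ≤ state A b x₀ u t i := by
    intro t
    induction t with
    | zero => exact hx
    | succ t ih =>
      intro i
      have hsum : 0 ≤ ∑ j, A i j * state A b x₀ u t j :=
        Finset.sum_nonneg fun j _ => mul_nonneg (hA i j) (ih j)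
      exact add_nonneg hsum (mul_nonneg (hu t) (hb i))
  exact ⟨hstate t, add_nonneg (Finset.sum_nonneg fun i _ => mul_nonneg (hc i) (hstate t i))
    (mul_nonneg hd (hu t))⟩

/-- A finitely generated shift-invariant cone of sequences that are non-negative at `0` yields a
positive realization of each of its members, also after exponential scaling. -/
theorem isInternallyPositive_of_mem_cone {n : ℕ} (hn : 0 < n) (w : Fin n → ℕ → ℝ)
    (hw₀ : ∀ i, 0 ≤ w i 0)
    (hw : ∀ j, (fun t => w j (t + 1)) ∈ Submodule.span ℝ≥0 (Set.range w))
    {G : ℕ → ℝ} (hG : G ∈ Submodule.span ℝ≥0 (Set.range w)) {ρ : ℝ} (hρ : 0 ≤ ρ) :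
    IsInternallyPositive fun t => ρ ^ t * G t := by
  simp only [Submodule.mem_span_range_iff_exists_fun] at hw hG
  choose α hα using hw
  obtain ⟨γ, hγ⟩ := hG
  have hα' : ∀ j t, w j (t + 1) = ∑ i, (α j i : ℝ) * w i t := fun j t => by
    simpa [NNReal.smul_def] using (congrFun (hα j) t).symm
  have hγ' : ∀ t, G t = ∑ j, (γ j : ℝ) * w j t := fun t => by
    simpa [NNReal.smul_def] using (congrFun hγ t).symm
  -- The shift in the generators `w`, transposed to act on coordinates and scaled by `ρ`. An impulse
  -- at time `0` first reaches the state at time `1`, so `b` holds coordinates of the once-shifted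
  -- `G`, and `d` must supply `G 0`.
  let A : Matrix (Fin n) (Fin n) ℝ := Matrix.of fun i j => ρ * α j i
  let b : Fin n → ℝ := fun i => ρ * ∑ j, (γ j : ℝ) * α j i
  -- The state is a coordinate vector of the shifted, scaled response. All `s` are needed because
  -- the induction step uses `s + 1`; the output is the case `s = 0`.
  have hstate : ∀ t s, ∑ i, state A b 0 (Pi.single 0 1) (t + 1) i * w i s
      = ρ ^ (t + 1) * G (t + 1 + s) := by
    intro t
    induction t with
    | zero =>
      intro s
      have h1 : state A b 0 (Pi.single 0 1) (0 + 1) = b := by simp [state]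
      rw [h1, zero_add, pow_one, add_comm 1 s, hγ']
      simp only [hα', b, Finset.mul_sum, Finset.sum_mul]
      rw [Finset.sum_comm]
      exact Finset.sum_congr rfl fun j _ => Finset.sum_congr rfl fun i _ => by ring
    | succ t ih =>
      intro s
      have h1 : ∀ i, state A b 0 (Pi.single 0 1) (t + 1 + 1) i
          = ∑ j, ρ * α j i * state A b 0 (Pi.single 0 1) (t + 1) j := by
        intro i
        rw [state, Pi.single_eq_of_ne (by omega)]
        simp [Matrix.mulVec, dotProduct, A]
      have h2 := ih (s + 1)
      rw [show t + 1 + 1 + s = t + 1 + (s + 1) by ring, pow_succ, mul_assoc, mul_left_comm, ← h2]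
      simp only [h1, hα', Finset.mul_sum, Finset.sum_mul]
      rw [Finset.sum_comm]
      exact Finset.sum_congr rfl fun j _ => Finset.sum_congr rfl fun i _ => by ring
  have hG₀ : 0 ≤ G 0 := by
    rw [hγ']
    exact Finset.sum_nonneg fun j _ => mul_nonneg (γ j).2 (hw₀ j)
  refine ⟨n, A, b, fun i => w i 0, G 0, hn, ?_, isPositiveSystem_of_nonneg
    (fun i j => mul_nonneg hρ (α j i).2)
    (fun i => mul_nonneg hρ (Finset.sum_nonneg fun j _ => mul_nonneg (γ j).2 (α j i).2)) hw₀ hG₀⟩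
  rintro (_ | t)
  · simp [output, state]
  · have := hstate t 0
    rw [output, Pi.single_eq_of_ne (by omega), dotProduct_comm]
    simpa [dotProduct] using this

/-! ### Cone membership -/

/-- A cone that contains `x ± ε vᵢ` contains `x` translated by the `ε`-cross-polytope of `v`. -/
theorem add_sum_smul_mem_cone {E ι : Type*} [AddCommGroup E] [Module ℝ E]
    (C : Submodule ℝ≥0 E) {x : E} (hx : x ∈ C) {ε : ℝ} (hε : 0 < ε) (s : Finset ι) (v : ι → E)
    (hadd : ∀ i ∈ s, x + ε • v i ∈ C) (hsub : ∀ i ∈ s, x - ε • v i ∈ C)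
    {d : ι → ℝ} (hd : ∑ i ∈ s, |d i| ≤ ε) : x + ∑ i ∈ s, d i • v i ∈ C := by
  have hsmul : ∀ {r : ℝ} {z : E}, 0 ≤ r → z ∈ C → r • z ∈ C := fun {r z} hr hz =>
    C.smul_mem (⟨r, hr⟩ : ℝ≥0) hz
  -- The target is a convex combination: weight `|d i| / ε` on `x ± ε • v i`, with the sign of `d
  -- i`, and the remaining weight on `x`.
  have hterm : ∀ i ∈ s, (|d i| / ε) • x + d i • v i ∈ C := by
    intro i hi
    rcases le_total 0 (d i) with h | h
    · have := hsmul (div_nonneg (abs_nonneg (d i)) hε.le) (hadd i hi)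
      rw [smul_add, smul_smul, div_mul_cancel₀ _ hε.ne'] at this
      rwa [abs_of_nonneg h] at this ⊢
    · have := hsmul (div_nonneg (abs_nonneg (d i)) hε.le) (hsub i hi)
      rw [smul_sub, smul_smul, div_mul_cancel₀ _ hε.ne', sub_eq_add_neg, ← neg_smul] at this
      simpa only [abs_of_nonpos h, neg_neg] using this
  have hrest : (1 - (∑ i ∈ s, |d i|) / ε) • x ∈ C :=
    hsmul (sub_nonneg.2 ((div_le_one hε).2 hd)) hx
  have := C.add_mem hrest (C.sum_mem hterm)
  rw [Finset.sum_add_distrib, ← Finset.sum_smul, ← Finset.sum_div, ← add_assoc, ← add_smul,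
    sub_add_cancel, one_smul] at this
  exact this

/-! ### Orbits of the shift -/

/-- If the shifts of a null sequence span a finite-dimensional space, then late shifts are
combinations of finitely many fixed shifts with arbitrarily small coefficients. -/
theorem exists_shift_eq_sum {e : ℕ → ℝ} (he : Filter.Tendsto e Filter.atTop (𝓝 0))
    (hfin : FiniteDimensional ℝ (Submodule.span ℝ (Set.range fun i t => e (t + i)))) :
    ∃ n : ℕ, ∀ δ > 0, ∀ᶠ m in Filter.atTop, ∃ d : ℕ → ℝ,
      (∀ t, e (t + m) = ∑ i ∈ Finset.range n, d i * e (t + i)) ∧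
        ∑ i ∈ Finset.range n, |d i| ≤ δ := by
  set f : ℕ → ℕ → ℝ := fun i t => e (t + i) with hf
  set V := Submodule.span ℝ (Set.range f) with hV
  obtain ⟨s, hs, hspan⟩ := Submodule.fg_span_iff_fg_span_finset_subset _ |>.1
    ((Submodule.fg_iff_finiteDimensional V).2 hfin)
  choose ι hι using hs
  obtain ⟨n, hn⟩ : ∃ n, ∀ y (hy : y ∈ s), ι hy < n := by
    refine ⟨s.attach.sup (fun y => ι y.2) + 1, fun y hy => Nat.lt_succ_of_le ?_⟩
    exact Finset.le_sup (f := fun y : s => ι y.2) (s.mem_attach ⟨y, hy⟩)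
  have hmem : ∀ i, f i ∈ V := fun i => Submodule.subset_span ⟨i, rfl⟩
  let F : (Fin n → ℝ) →ₗ[ℝ] V := Fintype.linearCombination ℝ fun i : Fin n => ⟨f i, hmem i⟩
  have hF : ∀ d : Fin n → ℝ, (F d : ℕ → ℝ) = ∑ i, d i • f i := by
    intro d
    simp [F, Fintype.linearCombination_apply]
  have hsurj : LinearMap.range F = ⊤ := by
    rw [LinearMap.range_eq_top]
    rintro ⟨x, hx⟩
    have hle : V ≤ Submodule.span ℝ (Set.range fun i : Fin n => f i) := by
      rw [hV, hspan]
      apply Submodule.span_mono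
      intro y hy
      exact ⟨⟨ι hy, hn y hy⟩, hι hy⟩
    obtain ⟨d, hd⟩ := (Submodule.mem_span_range_iff_exists_fun ℝ).1 (hle hx)
    exact ⟨d, Subtype.ext ((hF d).trans hd)⟩
  -- A linear choice of coefficients is continuous in finite dimension, so pointwise convergence of
  -- the shifts to `0` forces the coefficients to `0`.
  obtain ⟨ψ, hψ⟩ := F.exists_rightInverse_of_surjective hsurj
  have hψc : Continuous ψ := LinearMap.continuous_of_finiteDimensional ψ
  have hlim : Filter.Tendsto (fun m => (⟨f m, hmem m⟩ : V)) Filter.atTop (𝓝 0) := by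
    rw [tendsto_subtype_rng]
    exact tendsto_pi_nhds.2 fun t => he.comp (Filter.tendsto_add_atTop_nat t |>.congr
      fun m => add_comm m t)
  have hcoord : Filter.Tendsto (fun m => ∑ i, |ψ ⟨f m, hmem m⟩ i|) Filter.atTop (𝓝 0) := by
    have hc : Continuous fun v : V => ∑ i, |ψ v i| := by fun_prop
    simpa [Function.comp_def] using (hc.tendsto 0).comp hlim
  refine ⟨n, fun δ hδ => (hcoord.eventually_le_const hδ).mono fun m hm => ?_⟩
  refine ⟨fun i => if hi : i < n then ψ ⟨f m, hmem m⟩ ⟨i, hi⟩ else 0, fun t => ?_, ?_⟩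
  · have h1 : F (ψ ⟨f m, hmem m⟩) = ⟨f m, hmem m⟩ := LinearMap.congr_fun hψ _
    have h2 := congrFun ((hF _).symm.trans (congrArg Subtype.val h1)) t
    rw [Finset.sum_range]
    simpa [hf] using h2.symm
  · rw [Finset.sum_range]
    simpa using hm

/-! ### Positive realizations in the presence of a dominant pole -/

/-- A non-negative sequence `ρ^t (a + e_t)` with `a > 0`, where `e` is a null sequence with
finite-dimensional shift space, is internally positive. -/
theorem isInternallyPositive_of_dominant {e : ℕ → ℝ} {a M ρ : ℝ} (ha : 0 < a) (hρ : 0 ≤ ρ)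
    (hM : ∀ t, |e t| ≤ M) (he : Filter.Tendsto e Filter.atTop (𝓝 0))
    (hfin : FiniteDimensional ℝ (Submodule.span ℝ (Set.range fun i t => e (t + i))))
    (hpos : ∀ t, 0 ≤ a + e t) : IsInternallyPositive fun t => ρ ^ t * (a + e t) := by
  have hM₀ : 0 ≤ M := (abs_nonneg _).trans (hM 0)
  -- This makes `a ± ε e` non-negative.
  obtain ⟨ε, hε, hεM⟩ : ∃ ε > 0, ε * M ≤ a :=
    ⟨a / (M + 1), by positivity, by
      rw [div_mul_eq_mul_div, div_le_iff₀ (by positivity)]; nlinarith⟩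
  obtain ⟨n, hn⟩ := exists_shift_eq_sum he hfin
  -- The bound `min 1 ε` serves both `± ε • v m` (by `1`) and `v m` itself (by `ε`). Since `m > n`,
  -- the shifts that express `v m` are all among the generators, and `m > 0`.
  obtain ⟨m, hm, d, hd, hdε⟩ :=
    ((Filter.eventually_ge_atTop (n + 1)).and (hn (min 1 ε) (by positivity))).exists
  let v : ℕ → ℕ → ℝ := fun i t => e (t + i)
  let x : ℕ → ℝ := fun _ => a
  let S : Set (ℕ → ℝ) := ⋃ i ∈ Finset.range m, {x + ε • v i, x - ε • v i, x + v i}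
  have hSfin : S.Finite := (Finset.range m).finite_toSet.biUnion fun i _ => by simp
  obtain ⟨p, w, -, hw⟩ := hSfin.fin_param
  let C := Submodule.span ℝ≥0 (Set.range w)
  have hS : ∀ i < m, ∀ z ∈ ({x + ε • v i, x - ε • v i, x + v i} : Set (ℕ → ℝ)),
      z ∈ Set.range w := fun i hi z hz => by
    rw [hw]; exact Set.mem_biUnion (Finset.mem_coe.2 (Finset.mem_range.2 hi)) hz
  have hadd : ∀ i < m, x + ε • v i ∈ C := fun i hi =>
    Submodule.subset_span (hS i hi _ (by simp))
  have hsub : ∀ i < m, x - ε • v i ∈ C := fun i hi =>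
    Submodule.subset_span (hS i hi _ (by simp))
  have horb : ∀ i < m, x + v i ∈ C := fun i hi =>
    Submodule.subset_span (hS i hi _ (by simp))
  -- `x` is the midpoint of `x ± ε • v 0`.
  have hx : x ∈ C := by
    have := C.smul_mem (1 / 2 : ℝ≥0) (C.add_mem (hadd 0 (by omega)) (hsub 0 (by omega)))
    convert this using 1
    ext t
    simp [NNReal.smul_def]
    ring
  have hcomb : ∀ r : ℝ, |r| * min 1 ε ≤ ε → x + r • v m ∈ C := by
    intro r hr
    have hv : r • v m = ∑ i ∈ Finset.range n, (r * d i) • v i := by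
      ext t
      simp [v, hd, Finset.mul_sum, mul_assoc]
    rw [hv]
    refine add_sum_smul_mem_cone C hx hε _ v
      (fun i hi => hadd i (by have := Finset.mem_range.1 hi; omega))
      (fun i hi => hsub i (by have := Finset.mem_range.1 hi; omega)) ?_
    simp only [abs_mul, ← Finset.mul_sum]
    exact (mul_le_mul_of_nonneg_left hdε (abs_nonneg r)).trans hr
  have hcombε : ε * min 1 ε ≤ ε := mul_le_of_le_one_right hε.le (min_le_left _ _)
  have hadd' : ∀ i ≤ m, x + ε • v i ∈ C := fun i hi => hi.lt_or_eq.elim (hadd i) <| by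
    rintro rfl; exact hcomb ε (by rwa [abs_of_pos hε])
  have hsub' : ∀ i ≤ m, x - ε • v i ∈ C := fun i hi => hi.lt_or_eq.elim (hsub i) <| by
    rintro rfl
    rw [sub_eq_add_neg, ← neg_smul]
    exact hcomb (-ε) (by rwa [abs_neg, abs_of_pos hε])
  have horb' : ∀ i ≤ m, x + v i ∈ C := fun i hi => hi.lt_or_eq.elim (horb i) <| by
    rintro rfl
    rw [← one_smul ℝ (v i)]
    exact hcomb 1 (by simp)
  have hshift : ∀ i, (fun t => v i (t + 1)) = v (i + 1) := fun i => by
    ext t; simp only [v]; congr 1; ring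
  have hcases : ∀ j, ∃ i < m, w j = x + ε • v i ∨ w j = x - ε • v i ∨ w j = x + v i := by
    intro j
    have : w j ∈ S := hw ▸ Set.mem_range_self j
    simpa [S] using this
  have hp : 0 < p := by
    obtain ⟨j, -⟩ := hS 0 (by omega) _ (Set.mem_insert _ _)
    exact j.pos
  refine isInternallyPositive_of_mem_cone hp w (fun j => ?_) (fun j => ?_)
    (G := fun t => a + e t) ?_ hρ
  · obtain ⟨i, -, h | h | h⟩ := hcases j <;> rw [h]
    · have := mul_le_mul_of_nonneg_left ((neg_le_abs _).trans (hM (0 + i))) hε.le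
      simp only [Pi.add_apply, Pi.smul_apply, smul_eq_mul, x, v]
      linarith
    · have := mul_le_mul_of_nonneg_left ((le_abs_self _).trans (hM (0 + i))) hε.le
      simp only [Pi.sub_apply, Pi.smul_apply, smul_eq_mul, x, v]
      linarith
    · exact hpos _
  · obtain ⟨i, hi, h | h | h⟩ := hcases j <;> rw [h]
    · have := hadd' (i + 1) hi
      rwa [← hshift] at this
    · have := hsub' (i + 1) hi
      rwa [← hshift] at this
    · have := horb' (i + 1) hi
      rwa [← hshift] at this
  · exact horb 0 (by omega)

/-! ### Finite Hankel rank and decay -/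

/-- A sequence of finite Hankel rank has a finite-dimensional shift space. -/
theorem FiniteHankelRank.finiteDimensional_span_shift {h : ℕ → ℝ} (hh : FiniteHankelRank h) :
    FiniteDimensional ℝ (Submodule.span ℝ (Set.range fun i t => h (t + i))) := by
  have hfin : FiniteDimensional ℝ
      (Submodule.span ℝ {w : ℕ → ℝ | ∃ v : ℕ → ℝ, Memℓp v ∞ ∧ w = hankel h v}) :=
    Module.rank_lt_aleph0_iff.1 hh
  refine Submodule.finiteDimensional_of_le (S₂ := Submodule.span ℝ
    {w : ℕ → ℝ | ∃ v : ℕ → ℝ, Memℓp v ∞ ∧ w = hankel h v}) (Submodule.span_mono ?_)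
  rintro _ ⟨j, rfl⟩
  -- The `j`-th shift is the `j`-th Hankel column, the image of a unit sequence.
  refine ⟨Pi.single j 1, (memℓp_zero ((Set.finite_singleton j).subset ?_)).of_exponent_ge
    bot_le, ?_⟩
  · intro i hi
    by_contra hij
    exact hi (Pi.single_eq_of_ne hij _)
  · ext i
    rw [hankel, tsum_eq_single j fun k hk => by rw [Pi.single_eq_of_ne hk, mul_zero]]
    simp

/-- Exponential scaling preserves finite dimensionality of the shift space. -/
theorem finiteDimensional_span_shift_mul_pow {h : ℕ → ℝ}
    (hh : FiniteDimensional ℝ (Submodule.span ℝ (Set.range fun i t => h (t + i)))) (r : ℝ) :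
    FiniteDimensional ℝ
      (Submodule.span ℝ (Set.range fun i t => r ^ (t + i) * h (t + i))) := by
  let D : (ℕ → ℝ) →ₗ[ℝ] (ℕ → ℝ) := LinearMap.mulLeft ℝ (fun t => r ^ t)
  refine Submodule.finiteDimensional_of_le
    (S₂ := (Submodule.span ℝ (Set.range fun i t => h (t + i))).map D) (Submodule.span_le.2 ?_)
  rintro _ ⟨i, rfl⟩
  -- A shift of the scaled sequence is the diagonal scaling `D` of a shift of `h`, up to the
  -- constant `r ^ i`.
  have : (fun t => r ^ (t + i) * h (t + i)) = r ^ i • D fun t => h (t + i) := by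
    ext t
    simp [D]
    ring
  simp only [this]
  exact Submodule.smul_mem _ _ (Submodule.mem_map_of_mem (Submodule.subset_span ⟨i, rfl⟩))

/-- Members of a reproducing kernel Hilbert space decay like the square root of the diagonal of
the kernel. -/
theorem HasKernel.abs_apply_le {H : Type*} [NormedAddCommGroup H] [InnerProductSpace ℝ H]
    [RKHS ℝ H ℕ ℝ] {k : ℕ → ℕ → ℝ} (hH : HasKernel H k) {C r : ℝ} (hC : 0 ≤ C) (hr : 0 ≤ r)
    (hk : ∀ t, |k t t| ≤ C * r ^ (2 * t)) (h : H) (t : ℕ) : |h t| ≤ ‖h‖ * √C * r ^ t := by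
  obtain ⟨kt, hkt, hrep⟩ := hH t
  have hnorm : ‖kt‖ ≤ √C * r ^ t := by
    refine abs_le_of_sq_le_sq' ?_ (by positivity) |>.2
    -- The squared norm of the section at `t` is `k t t`.
    rw [← real_inner_self_eq_norm_sq, hrep, hkt, mul_pow, Real.sq_sqrt hC, ← pow_mul, mul_comm t]
    exact (le_abs_self _).trans (hk t)
  rw [← hrep h, mul_assoc]
  exact (abs_real_inner_le_norm h kt).trans (mul_le_mul_of_nonneg_left hnorm (norm_nonneg h))

end PosIdent

theorem mainTheorem1
    -- a stable Mercer kernel and its reproducing kernel Hilbert space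
    (k : ℕ → ℕ → ℝ) (hk : PosIdent.IsMercerKernel k) (hstable : PosIdent.IsStableKernel k)
    {H : Type*} [NormedAddCommGroup H] [InnerProductSpace ℝ H] [CompleteSpace H]
    [RKHS ℝ H ℕ ℝ] (hH : PosIdent.HasKernel H k)
    -- the input, the sampling times and the measurements
    (u : ℤ → ℝ) (hu : Memℓp u ∞) {N : ℕ} (τ : Fin N → ℤ) (y : Fin N → ℝ)
    -- the parameters of the problem
    (ρ lam aMin : ℝ) (hρ : ρ ∈ Set.Ioo (0 : ℝ) 1) (hlam : 0 < lam) (haMin : 0 < aMin)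
    -- the decay of the kernel's diagonal
    (hdom : ∃ C ρd : ℝ, 0 ≤ C ∧ ρd ∈ Set.Ioo 0 ρ ∧ ∀ t : ℕ, |k t t| ≤ C * ρd ^ (2 * t))
    (a : ℝ) (h : H) (hsol : PosIdent.IsSolution u τ y ρ lam aMin a h)
    (g : ℕ → ℝ) (hg : ∀ t, g t = h t + a * ρ ^ t) :
    Memℓp g 1 ∧ PosIdent.IsInternallyPositive g := by
  obtain ⟨C, r, hC, ⟨hr₀, hrρ⟩, hkC⟩ := hdom
  obtain ⟨⟨hpos, hrank, ha⟩, -⟩ := hsol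
  have hh := hH.abs_apply_le hC hr₀.le hkC h
  have hρ₀ : 0 < ρ := hρ.1
  set M := ‖h‖ * √C
  have hM : 0 ≤ M := by positivity
  refine ⟨memℓp_gen ?_, ?_⟩
  · simp only [ENNReal.toReal_one, Real.rpow_one, Real.norm_eq_abs]
    refine Summable.of_nonneg_of_le (fun _ => abs_nonneg _) (fun t => ?_)
      (((summable_geometric_of_lt_one hr₀.le (hrρ.trans hρ.2)).mul_left M).add
        ((summable_geometric_of_lt_one hρ₀.le hρ.2).mul_left |a|))
    rw [hg]
    refine (abs_add_le _ _).trans (add_le_add (hh t) ?_)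
    rw [abs_mul, abs_of_pos (pow_pos hρ₀ t)]
  · have he : ∀ t, |ρ⁻¹ ^ t * h t| ≤ M * (r / ρ) ^ t := fun t => by
      rw [abs_mul, abs_of_pos (pow_pos (inv_pos.2 hρ₀) t)]
      refine (mul_le_mul_of_nonneg_left (hh t) (by positivity)).trans_eq ?_
      rw [div_eq_mul_inv, mul_pow]
      ring
    have hq₀ : 0 ≤ r / ρ := by positivity
    have hq₁ : r / ρ < 1 := (div_lt_one hρ₀).2 hrρ
    have hg' : g = fun t => ρ ^ t * (a + ρ⁻¹ ^ t * h t) := by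
      ext t
      rw [hg, mul_add, ← mul_assoc, ← mul_pow, mul_inv_cancel₀ hρ₀.ne', one_pow]
      ring
    rw [hg']
    refine PosIdent.isInternallyPositive_of_dominant (M := M) (haMin.trans_le ha) hρ₀.le
      (fun t => (he t).trans (mul_le_of_le_one_right hM (pow_le_one₀ hq₀ hq₁.le)))
      (squeeze_zero_norm he ?_)
      (PosIdent.finiteDimensional_span_shift_mul_pow hrank.finiteDimensional_span_shift _)
      (fun t => ?_)
    · simpa using (tendsto_pow_atTop_nhds_zero_of_lt_one hq₀ hq₁).const_mul M
    · have h1 : 0 ≤ ρ ^ t * (a + ρ⁻¹ ^ t * h t) := by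
        rw [← congrFun hg' t, hg]
        exact hpos t
      exact nonneg_of_mul_nonneg_right h1 (pow_pos hρ₀ t)
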